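/- Let $0<\delta\le 1/2$. A $\delta$-SHPED (symmetric homogeneous partial edge drawing with ratio $\delta$) of a graph $G$ is a placement of the vertices of $G$ at pairwise distinct points of the Euclidean plane such that the stubs of the edges are pairwise disjoint. Here every edge $uv$ has exactly two stubs, one at each endpoint: the stub at $u$ is the relatively open segment (without its endpoints) that starts at $u$, points towards $v$ and has length $\delta\,|uv|$, and the stub at $v$ is defined in the same way with $u$ and $v$ exchanged. Two different stubs, whether of the same edge, of edges with a common vertex, or of disjoint edges, must not share a point. Theorem. For every integer $n > 240$, the complete graph $K_n$ does not admit a $1/4$-SHPED. -/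

import Mathlib

/-- The stub at `a` of the straight-line edge `ab`, for the stub--edge length ratio `δ`: the
relatively open initial piece of the segment from `a` to `b` (without its two endpoints) whose
length is `δ` times the length of the edge. -/
def stub (δ : ℝ) (a b : EuclideanSpace ℝ (Fin 2)) : Set (EuclideanSpace ℝ (Fin 2)) :=
  AffineMap.lineMap a b '' Set.Ioo (0 : ℝ) δ

/-- The placement `p` of the vertices of `G` at distinct points of the plane is a `δ`-SHPED of `G`
(a crossing-free symmetric homogeneous partial edge drawing with ratio `δ`). Every edge is drawn as
two stubs, one at each of its endpoints, each of `δ` times the length of the edge, and no two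
different stubs intersect. A stub corresponds to a dart of `G`, that is, to an edge together with
the choice of the endpoint it is incident to. -/
structure IsSHPED {V : Type*} (G : SimpleGraph V) (δ : ℝ) (p : V → EuclideanSpace ℝ (Fin 2)) :
    Prop where
  injective : Function.Injective p
  disjoint : ∀ d e : G.Dart, d ≠ e →
    Disjoint (stub δ (p d.fst) (p d.snd)) (stub δ (p e.fst) (p e.snd))

/-- The graph `G` admits a `δ`-SHPED. -/
def HasSHPED {V : Type*} (G : SimpleGraph V) (δ : ℝ) : Prop :=
  ∃ p : V → EuclideanSpace ℝ (Fin 2), IsSHPED G δ p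

/-! Among all vertex triples take `a`, `b`, `c` spanning a triangle of maximal area. All barycentric
coordinates `X`, `Y`, `Z` of the vertices then lie in `[-1, 1]`, and since stubs are affinely
invariant only these coordinates matter (`StubFrame`). No three vertices are collinear, so every
other vertex lies strictly beyond a side or strictly inside the triangle.

Beyond `ab`, the stubs towards `c` and those along `ab` force `X / Y` into `[1/3, 3]`. Eight bands
of ratio `4/3` and seven strips of height `1/7` give 56 cells. Two vertices in one cell would have
intersecting stubs towards triangle corners (`cap_pair`), so a cap holds at most 56 vertices.

Inside, consider the kite where `X` is largest, with `u = Y / X` and `v = Z / X` in `(0, 1]`, cut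
into nine square cells of side `1/3`. Two vertices in one cell have crossing edges to two corners,
and disjointness of the stubs forces `Precedes` in one direction (`precedes_or`): both coordinates
grow by a factor of at least `4/3`, while one of them grows by a bounded factor. Cells therefore
hold at most 1, 3 or 7 vertices, and a kite at most `5 * 1 + 3 * 3 + 7 = 21`. In total there are at
most `3 + 3 * 21 + 3 * 56 = 234` vertices. -/

/-! ### Chains of points with geometrically growing coordinates. -/

/-- Two points with the projective coordinates `u`, `v` relative to `a`, of which `p` is closer to
`a` than `q`, in a range of ratios. -/
def Precedes {ι : Type*} (u v : ι → ℝ) (p q : ι) : Prop :=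
  u p * (1 + u q + v q) ≤ 3 * (u q - u p) ∧ v p * (1 + u q + v q) ≤ 3 * (v q - v p) ∧
  (u q - u p ≤ 3 * u p * (1 + u q + v q) ∨ v q - v p ≤ 3 * v p * (1 + u q + v q))

namespace Precedes

variable {ι : Type*} {u v : ι → ℝ} {p q : ι}

theorem swap (h : Precedes v u p q) : Precedes u v p q := by
  have e : 1 + v q + u q = 1 + u q + v q := by ring
  unfold Precedes at h
  rw [e] at h
  exact ⟨h.2.1, h.1, h.2.2.symm⟩

theorem ratio_le (h : Precedes u v p q) (hu : 0 < u p) (hv : 0 < v p) (hu' : 0 < u q)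
    (hv' : 0 < v q) :
    4 * u p ≤ 3 * u q ∧ 4 * v p ≤ 3 * v q := by
  obtain ⟨h₁, h₂, -⟩ := h
  have huq : u p < u q := by nlinarith
  have hvq : v p < v q := by nlinarith
  constructor <;> nlinarith

end Precedes

/-- Removing the element with the largest value shrinks the upper bound by `3/4`. -/
theorem card_le_of_ratio {ι : Type*} {f : ι → ℝ} {m : ℝ} (hm : 0 < m) (k : ℕ) :
    ∀ (M : ℝ) (S : Finset ι), (∀ i ∈ S, m ≤ f i ∧ f i ≤ M) →
    (∀ i ∈ S, ∀ j ∈ S, i ≠ j → 4 * f i ≤ 3 * f j ∨ 4 * f j ≤ 3 * f i) →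
    M * (3 / 4) ^ k < m → S.card ≤ k := by
  classical
  induction k with
  | zero =>
    intro M S hS _ hM
    rw [Nat.le_zero, Finset.card_eq_zero, Finset.eq_empty_iff_forall_notMem]
    intro i hi
    have := hS i hi
    linarith
  | succ k ih =>
    intro M S hS hp hM
    rcases S.eq_empty_or_nonempty with rfl | hne
    · simp
    obtain ⟨x, hx, hmax⟩ := S.exists_max_image f hne
    rw [← Finset.card_erase_add_one hx]
    refine Nat.succ_le_succ (ih (3 / 4 * M) _ ?_ ?_ ?_)
    · intro i hi
      obtain ⟨hix, hi⟩ := Finset.mem_erase.1 hi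
      refine ⟨(hS i hi).1, ?_⟩
      have h₁ := hmax i hi
      have h₂ := hS i hi
      have h₃ := hS x hx
      rcases hp i hi x hx hix with h | h <;> linarith
    · intro i hi j hj
      exact hp i (Finset.mem_of_mem_erase hi) j (Finset.mem_of_mem_erase hj)
    · rw [pow_succ] at hM
      linarith

/-- A finite set of points with positive coordinates that is totally ordered by `Precedes`. -/
structure IsPrecedesChain {ι : Type*} (u v : ι → ℝ) (S : Finset ι) : Prop where
  pos : ∀ i ∈ S, 0 < u i ∧ 0 < v i
  total : ∀ i ∈ S, ∀ j ∈ S, i ≠ j → Precedes u v i j ∨ Precedes u v j i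

namespace IsPrecedesChain

variable {ι : Type*} {u v : ι → ℝ} {S : Finset ι}

theorem swap (h : IsPrecedesChain u v S) : IsPrecedesChain v u S :=
  ⟨fun i hi => (h.pos i hi).symm,
    fun i hi j hj hij => (h.total i hi j hj hij).imp Precedes.swap Precedes.swap⟩

theorem card_le (h : IsPrecedesChain u v S) {m M : ℝ} (hm : 0 < m)
    (hS : ∀ i ∈ S, m ≤ u i ∧ u i ≤ M) {k : ℕ} (hk : M * (3 / 4) ^ k < m) : S.card ≤ k := by
  refine card_le_of_ratio hm k M S hS (fun i hi j hj hij => ?_) hk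
  exact (h.total i hi j hj hij).imp
    (fun hp => (hp.ratio_le (h.pos i hi).1 (h.pos i hi).2 (h.pos j hj).1 (h.pos j hj).2).1)
    (fun hp => (hp.ratio_le (h.pos j hj).1 (h.pos j hj).2 (h.pos i hi).1 (h.pos i hi).2).1)

theorem card_le_three (h : IsPrecedesChain u v S) (hS : ∀ i ∈ S, 1 / 3 < u i ∧ u i ≤ 2 / 3) :
    S.card ≤ 3 :=
  h.card_le (m := 1 / 3) (M := 2 / 3) (by norm_num) (fun i hi => ⟨(hS i hi).1.le, (hS i hi).2⟩)
    (by norm_num)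

theorem card_le_one (h : IsPrecedesChain u v S) (hS : ∀ i ∈ S, 2 / 3 < u i ∧ u i ≤ 1) :
    S.card ≤ 1 := by
  have key : ∀ i ∈ S, ∀ j ∈ S, ¬ Precedes u v i j := by
    intro i hi j hj hp
    have h₁ := hp.1
    have h₂ := hS i hi
    have h₃ := hS j hj
    have h₄ := (h.pos j hj).2
    -- The left side of `h₁` exceeds `2/3 * (1 + 2/3) = 10/9`, while the right side is below 1.
    nlinarith
  rw [Finset.card_le_one]
  intro i hi j hj
  by_contra hij
  exact (h.total i hi j hj hij).elim (key i hi j hj) (key j hj i hi)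

theorem card_le_seven (h : IsPrecedesChain u v S) (hS : ∀ i ∈ S, u i ≤ 1 / 3 ∧ v i ≤ 1 / 3) :
    S.card ≤ 7 := by
  rcases S.eq_empty_or_nonempty with rfl | hne
  · simp
  obtain ⟨p, hp, hmin⟩ := S.exists_min_image u hne
  obtain ⟨q, hq, hmax⟩ := S.exists_max_image u hne
  have hup := h.pos p hp
  have huq := h.pos q hq
  have mono : ∀ i ∈ S, ∀ j ∈ S, u i ≤ u j → v i ≤ v j := by
    intro i hi j hj hij
    by_cases e : i = j
    · rw [e]
    have hpi := h.pos i hi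
    have hpj := h.pos j hj
    rcases h.total i hi j hj e with ht | ht
    · linarith [(ht.ratio_le hpi.1 hpi.2 hpj.1 hpj.2).2]
    · linarith [(ht.ratio_le hpj.1 hpj.2 hpi.1 hpi.2).1]
  -- Here `1 + u q + v q ≤ 5/3`, so the increment is at most five times the smaller value. The bound
  -- 7 then comes from `6 * (3/4)^7 < 1`.
  have key : u q ≤ 6 * u p ∨ v q ≤ 6 * v p := by
    by_cases e : p = q
    · left; rw [← e]; linarith
    have hSq := hS q hq
    rcases h.total p hp q hq e with ht | ht
    · refine ht.2.2.imp (fun h₁ => ?_) fun h₁ => ?_ <;> nlinarith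
    · linarith [(ht.ratio_le huq.1 huq.2 hup.1 hup.2).1, hmin q hq]
  rcases key with hk | hk
  · exact h.card_le hup.1 (M := 6 * u p) (fun i hi => ⟨hmin i hi, (hmax i hi).trans hk⟩)
      (by norm_num; linarith)
  · exact h.swap.card_le hup.2 (M := 6 * v p) (fun i hi => ⟨mono p hp i hi (hmin i hi),
      (mono i hi q hq (hmax i hi)).trans hk⟩) (by norm_num; linarith)

end IsPrecedesChain

/-! ### Stub separation and general position. -/

/-- No two different stubs of the complete graph on points with the affine coordinates `X`, `Y`
meet, for the ratio `1 / 4`. -/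
def StubSep {ι : Type*} (X Y : ι → ℝ) : Prop :=
  ∀ i j k l, i ≠ j → k ≠ l → (i ≠ k ∨ j ≠ l) → ∀ s t : ℝ, 0 < s → s < 1 / 4 → 0 < t →
    t < 1 / 4 → (1 - s) * X i + s * X j = (1 - t) * X k + t * X l →
    (1 - s) * Y i + s * Y j = (1 - t) * Y k + t * Y l → False

namespace StubSep

variable {ι : Type*} {X Y : ι → ℝ}

/-- No point lies between two others. -/
theorem not_between (h : StubSep X Y) {i j k : ι} (hij : i ≠ j) (hik : i ≠ k)
    (hjk : j ≠ k) {t : ℝ} (ht₀ : 0 ≤ t) (ht₁ : t ≤ 1) (hX : X k = (1 - t) * X i + t * X j)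
    (hY : Y k = (1 - t) * Y i + t * Y j) : False := by
  rcases le_total (1 / 2) t with ht | ht
  · refine h i k i j hik hij (Or.inr hjk.symm) (1 / 8) (t / 8) (by norm_num) (by norm_num)
      (by linarith) (by linarith) ?_ ?_
    · rw [hX]; ring
    · rw [hY]; ring
  · refine h j k j i hjk hij.symm (Or.inr hik.symm) (1 / 8) ((1 - t) / 8) (by norm_num)
      (by norm_num) (by linarith) (by linarith) ?_ ?_
    · rw [hX]; ring
    · rw [hY]; ring

theorem not_collinear (h : StubSep X Y) {i j k : ι} (hij : i ≠ j) (hik : i ≠ k)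
    (hjk : j ≠ k) {t : ℝ} (hX : X k = (1 - t) * X i + t * X j)
    (hY : Y k = (1 - t) * Y i + t * Y j) : False := by
  rcases lt_or_ge t 0 with ht | ht
  · have h₁ : (1 - t) ≠ 0 := by linarith
    refine h.not_between (i := j) (j := k) (k := i) hjk hij.symm hik.symm (t := (1 - t)⁻¹)
      (inv_nonneg.2 (by linarith)) (inv_le_one_of_one_le₀ (by linarith)) ?_ ?_
    · rw [hX]; field_simp; ring
    · rw [hY]; field_simp; ring
  rcases le_or_gt t 1 with ht₁ | ht₁
  · exact h.not_between hij hik hjk ht ht₁ hX hY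
  · have h₁ : t ≠ 0 := by linarith
    refine h.not_between (i := i) (j := k) (k := j) hik hij hjk.symm (t := t⁻¹)
      (inv_nonneg.2 (by linarith)) (inv_le_one_of_one_le₀ ht₁.le) ?_ ?_
    · rw [hX]; field_simp; ring
    · rw [hY]; field_simp; ring

end StubSep

/-! ### Barycentric frames and crossings of edges to the corners. -/

/-- Barycentric coordinates `X`, `Y`, `Z` of a family of points with respect to three of its members
`a`, `b`, `c`, all of absolute value at most one, such that no two different stubs of the complete
graph for the ratio `1 / 4` meet. -/
structure StubFrame {ι : Type*} (a b c : ι) (X Y Z : ι → ℝ) : Prop where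
  sum_eq : ∀ i, X i + Y i + Z i = 1
  coord_a : X a = 1 ∧ Y a = 0 ∧ Z a = 0
  coord_b : X b = 0 ∧ Y b = 1 ∧ Z b = 0
  coord_c : X c = 0 ∧ Y c = 0 ∧ Z c = 1
  bound_x : ∀ i, -1 ≤ X i ∧ X i ≤ 1
  bound_y : ∀ i, -1 ≤ Y i ∧ Y i ≤ 1
  bound_z : ∀ i, -1 ≤ Z i ∧ Z i ≤ 1
  sep : StubSep X Y

namespace StubFrame

variable {ι : Type*} {a b c : ι} {X Y Z : ι → ℝ}

theorem rotate (h : StubFrame a b c X Y Z) : StubFrame b c a Y Z X where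
  sum_eq i := by linarith [h.sum_eq i]
  coord_a := ⟨h.coord_b.2.1, h.coord_b.2.2, h.coord_b.1⟩
  coord_b := ⟨h.coord_c.2.1, h.coord_c.2.2, h.coord_c.1⟩
  coord_c := ⟨h.coord_a.2.1, h.coord_a.2.2, h.coord_a.1⟩
  bound_x := h.bound_y
  bound_y := h.bound_z
  bound_z := h.bound_x
  sep i j k l hij hkl hne s t hs hs' ht ht' e₁ e₂ := by
    refine h.sep i j k l hij hkl hne s t hs hs' ht ht' ?_ e₁
    have hi := h.sum_eq i
    have hj := h.sum_eq j
    have hk := h.sum_eq k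
    have hl := h.sum_eq l
    linear_combination (1 - s) * hi + s * hj - (1 - t) * hk - t * hl - e₁ - e₂

theorem swap (h : StubFrame a b c X Y Z) : StubFrame b a c Y X Z where
  sum_eq i := by linarith [h.sum_eq i]
  coord_a := ⟨h.coord_b.2.1, h.coord_b.1, h.coord_b.2.2⟩
  coord_b := ⟨h.coord_a.2.1, h.coord_a.1, h.coord_a.2.2⟩
  coord_c := ⟨h.coord_c.2.1, h.coord_c.1, h.coord_c.2.2⟩
  bound_x := h.bound_y
  bound_y := h.bound_x
  bound_z := h.bound_z
  sep i j k l hij hkl hne s t hs hs' ht ht' e₁ e₂ :=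
    h.sep i j k l hij hkl hne s t hs hs' ht ht' e₂ e₁

theorem ne (h : StubFrame a b c X Y Z) : a ≠ b := by
  rintro rfl
  linarith [h.coord_a.1, h.coord_b.1]

theorem z_ne_zero (h : StubFrame a b c X Y Z) {p : ι} (ha : p ≠ a) (hb : p ≠ b) : Z p ≠ 0 := by
  intro hz
  have hs := h.sum_eq p
  refine h.sep.not_collinear h.ne ha.symm hb.symm (t := Y p) ?_ ?_
  · rw [h.coord_a.1, h.coord_b.1]; linarith
  · rw [h.coord_a.2.1, h.coord_b.2.1]; ring

/-- Two points are not on a line through `c`. -/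
theorem det_ne_zero (h : StubFrame a b c X Y Z) {p q : ι} (hpq : p ≠ q) (hp : p ≠ c) (hq : q ≠ c)
    (hX : X q ≠ 0) : X p * Y q - Y p * X q ≠ 0 := by
  intro hd
  refine h.sep.not_collinear hq.symm hp.symm hpq.symm (t := X p / X q) ?_ ?_
  · rw [h.coord_c.1]; field_simp; ring
  · rw [h.coord_c.2.1]; field_simp; linarith

/-- The edges `pc` and `qa` do not cross in the quarters next to `p` and `q`. -/
theorem not_cross_near (h : StubFrame a b c X Y Z) {p q : ι} (hpq : p ≠ q) (hp : p ≠ c)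
    (hq : q ≠ a) (hE : 0 < Y p * Z q - Z p * Y q)
    (hD : 0 < X p * Y q - Y p * X q) (hE' : 3 * (Y p * Z q - Z p * Y q) < Y q)
    (hD' : 3 * (X p * Y q - Y p * X q) < Y p) : False := by
  have hsp := h.sum_eq p
  have hsq := h.sum_eq q
  -- `N` is the common denominator in Cramer's rule for the crossing of `pc` and `qa`; its two
  -- expressions turn `hE'` and `hD'` into parameters below `1/4`.
  obtain ⟨N, hN⟩ : ∃ N, N = Y q + (Y p * Z q - Z p * Y q) := ⟨_, rfl⟩
  have hN' : N = Y p + (X p * Y q - Y p * X q) := by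
    rw [hN]; linear_combination (-(Y q)) * hsp + Y p * hsq
  have hN₀ : 0 < N := by linarith
  refine h.sep p c q a hp hq (Or.inl hpq) ((Y p * Z q - Z p * Y q) / N)
    ((X p * Y q - Y p * X q) / N) (by positivity) ?_ (by positivity) ?_ ?_ ?_
  · rw [div_lt_iff₀ hN₀]; linarith
  · rw [div_lt_iff₀ hN₀]; linarith
  · rw [h.coord_a.1, h.coord_c.1]
    have e₁ : 1 - (Y p * Z q - Z p * Y q) / N = Y q / N := by field_simp; linarith
    have e₂ : 1 - (X p * Y q - Y p * X q) / N = Y p / N := by field_simp; linarith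
    rw [e₁, e₂]; field_simp; ring
  · rw [h.coord_a.2.1, h.coord_c.2.1]
    have e₁ : 1 - (Y p * Z q - Z p * Y q) / N = Y q / N := by field_simp; linarith
    have e₂ : 1 - (X p * Y q - Y p * X q) / N = Y p / N := by field_simp; linarith
    rw [e₁, e₂]; field_simp; ring

/-- The edges `pc` and `qa` do not cross in the quarters next to `p` and `a`. -/
theorem not_cross_far (h : StubFrame a b c X Y Z) {p q : ι} (hp : p ≠ c) (hpa : p ≠ a)
    (hq : q ≠ a) (hYp : 0 < Y p) (hE : 0 < Y p * Z q - Z p * Y q)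
    (hE' : 3 * (Y p * Z q - Z p * Y q) < Y q)
    (hD' : 3 * Y p < X p * Y q - Y p * X q) : False := by
  have hsp := h.sum_eq p
  have hsq := h.sum_eq q
  obtain ⟨N, hN⟩ : ∃ N, N = Y q + (Y p * Z q - Z p * Y q) := ⟨_, rfl⟩
  have hN' : N = Y p + (X p * Y q - Y p * X q) := by
    rw [hN]; linear_combination (-(Y q)) * hsp + Y p * hsq
  have hN₀ : 0 < N := by linarith
  have e₁ : 1 - (Y p * Z q - Z p * Y q) / N = Y q / N := by field_simp; linarith
  have e₂ : 1 - Y p / N = (X p * Y q - Y p * X q) / N := by field_simp; linarith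
  refine h.sep p c a q hp hq.symm (Or.inl hpa) ((Y p * Z q - Z p * Y q) / N)
    (Y p / N) (by positivity) ?_ (by positivity) ?_ ?_ ?_
  · rw [div_lt_iff₀ hN₀]; linarith
  · rw [div_lt_iff₀ hN₀]; linarith
  · rw [h.coord_a.1, h.coord_c.1, e₁, e₂]; field_simp; ring
  · rw [h.coord_a.2.1, h.coord_c.2.1, e₁, e₂]; field_simp; ring

/-! ### Points beyond the edge `ab` -/

/-- Otherwise `X p ≤ 1` gives `Y p < 1/3` and `-Z p < 1/3`, so `pc` crosses `ab` in the quarters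
next to `p` and `a`. -/
theorem x_le_three_mul_y (h : StubFrame a b c X Y Z) {p : ι} (hZ : Z p < 0) :
    X p ≤ 3 * Y p := by
  have hs := h.sum_eq p
  have hX := (h.bound_x p).2
  have hY := (h.bound_y p).2
  by_contra! hlt
  have hpos : 0 < 1 - Z p := by linarith
  have hpc : p ≠ c := by rintro rfl; linarith [h.coord_c.2.2]
  have hpa : p ≠ a := by rintro rfl; linarith [h.coord_a.2.2]
  refine h.sep p c a b hpc h.ne (Or.inl hpa) (-Z p / (1 - Z p)) (Y p / (1 - Z p)) ?_ ?_ ?_ ?_ ?_ ?_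
  · apply div_pos <;> linarith
  · rw [div_lt_iff₀ hpos]; linarith
  · apply div_pos <;> linarith
  · rw [div_lt_iff₀ hpos]; linarith
  · rw [h.coord_a.1, h.coord_b.1, h.coord_c.1]; field_simp; linarith
  · rw [h.coord_a.2.1, h.coord_b.2.1, h.coord_c.2.1]; field_simp; ring

theorem cap_estimate {x y s x' y' s' : ℝ} (hs : 0 < s) (hs₁ : s ≤ 1) (hs' : 0 < s')
    (hs₁' : s' ≤ 1) (hy : 0 < y) (hy' : 0 < y') (hxy : x + y = 1 + s) (hxy' : x' + y' = 1 + s')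
    (hx : x ≤ 3 * y) (hr : x * y' ≤ 4 / 3 * (y * x')) (hd : s - s' < 1 / 7) :
    3 * (s * y' - s' * y) < y' := by
  -- The constant is `3/4 * 3/4 + 1/4`: in the worst case `x = 3 * y`, the `x` part of `x + y` loses
  -- the factor `3/4`.
  have h₁ : 13 / 16 * (1 + s) * y' ≤ (1 + s') * y := by nlinarith
  have h₂ : s' * (13 / 16 * (1 + s) * y') ≤ s' * ((1 + s') * y) :=
    mul_le_mul_of_nonneg_left h₁ hs'.le
  have h₃ : 3 * (s * (1 + s') - s' * (13 / 16 * (1 + s))) < 1 + s' := by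
    rcases le_total s' s with h | h <;> nlinarith
  have h₄ := mul_lt_mul_of_pos_right h₃ hy'
  have h₅ : (1 + s') * (3 * (s * y' - s' * y)) < (1 + s') * y' := by nlinarith
  exact lt_of_mul_lt_mul_left h₅ (by linarith)

theorem cap_pair (h : StubFrame a b c X Y Z) {p q : ι} (hpq : p ≠ q) (hp : Z p < 0) (hq : Z q < 0)
    (hd : |Z p - Z q| < 1 / 7) (hr : X p * Y q < 4 / 3 * (Y p * X q))
    (hD : 0 < X p * Y q - Y p * X q) : False := by
  have hsp := h.sum_eq p
  have hsq := h.sum_eq q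
  have hXp := (h.bound_x p).2
  have hYp := (h.bound_y p).2
  have hXq := (h.bound_x q).2
  have hYq := (h.bound_y q).2
  have hZp := (h.bound_z p).1
  have hZq := (h.bound_z q).1
  have h₁ := h.x_le_three_mul_y hp
  have h₂ := h.swap.x_le_three_mul_y hq
  obtain ⟨hd₁, hd₂⟩ := abs_lt.1 hd
  have ne (r s) (hr : Z r < 0) (hs : 0 ≤ Z s) : r ≠ s := by rintro rfl; linarith
  have hpc := ne p c hp (by rw [h.coord_c.2.2]; norm_num)
  have hqc := ne q c hq (by rw [h.coord_c.2.2]; norm_num)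
  have hqa := ne q a hq (by rw [h.coord_a.2.2])
  have hpb := ne p b hp (by rw [h.coord_b.2.2])
  have hYp₀ : 0 < Y p := by linarith
  have hXp₀ : 0 < X p := by linarith
  have hYq₀ : 0 < Y q := by linarith
  have hXq₀ : 0 < X q := by linarith
  have e₁ : 3 * (-Z p * Y q - -Z q * Y p) < Y q :=
    cap_estimate (x := X p) (x' := X q) (by linarith) (by linarith) (by linarith) (by linarith)
      hYp₀ hYq₀ (by linarith) (by linarith) h₁ (by linarith) (by linarith)
  have e₂ : 3 * (-Z q * X p - -Z p * X q) < X p :=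
    cap_estimate (x := Y q) (x' := Y p) (by linarith) (by linarith) (by linarith) (by linarith)
      hXq₀ hXp₀ (by linarith) (by linarith) h₂ (by linarith) (by linarith)
  -- The sign decides which edges cross: `pc` with `qa`, or `qc` with `pb`.
  rcases lt_or_ge 0 (Y p * Z q - Z p * Y q) with hE | hE
  · refine h.not_cross_near hpq hpc hqa hE hD (by linarith) ?_
    nlinarith
  · refine h.swap.not_cross_near hpq.symm hqc hpb ?_ (by linarith) (by linarith) ?_
    · have : X p * Y q * -Z q > Y p * X q * -Z q :=
        mul_lt_mul_of_pos_right (by linarith) (by linarith)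
      have : X q * (Y p * Z q - Z p * Y q) ≤ 0 := mul_nonpos_of_nonneg_of_nonpos hXq₀.le hE
      have : 0 < Y q * (X q * Z p - Z q * X p) := by linarith
      exact pos_of_mul_pos_right this hYq₀.le
    · nlinarith

theorem card_cap_le [Fintype ι] (h : StubFrame a b c X Y Z) :
    (Finset.univ.filter fun i => Z i < 0).card ≤ 56 := by
  have hband : ∀ i, Z i < 0 → ∃ k < 8, (4 / 3 : ℝ) ^ k * Y i ≤ 3 * X i ∧
      3 * X i < (4 / 3 : ℝ) ^ (k + 1) * Y i := by
    intro i hi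
    have hsi := h.sum_eq i
    have h₁ := h.x_le_three_mul_y hi
    have h₂ := h.swap.x_le_three_mul_y hi
    have hY : 0 < Y i := by linarith
    obtain ⟨k, hk₁, hk₂⟩ := exists_nat_pow_near (x := 3 * X i / Y i) (y := (4 / 3 : ℝ))
      ((one_le_div hY).2 h₂) (by norm_num)
    rw [le_div_iff₀ hY] at hk₁
    rw [div_lt_iff₀ hY] at hk₂
    refine ⟨k, ?_, hk₁, hk₂⟩
    by_contra! hk
    have h₃ : (4 / 3 : ℝ) ^ 8 ≤ (4 / 3 : ℝ) ^ k := pow_le_pow_right₀ (by norm_num) hk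
    have h₄ : (9 : ℝ) < (4 / 3 : ℝ) ^ 8 := by norm_num
    nlinarith
  choose! k hk hk₁ hk₂ using hband
  have hcard : (Finset.range 8 ×ˢ Finset.Icc 1 7).card = 56 := rfl
  rw [← hcard]
  refine Finset.card_le_card_of_injOn (fun i => (k i, ⌈7 * -Z i⌉₊)) ?_ ?_
  · intro i hi
    have hi' : Z i < 0 := by simpa using hi
    have := (h.bound_z i).1
    simp only [Finset.coe_product, Set.mem_prod, Finset.mem_coe, Finset.mem_range, Finset.mem_Icc]
    refine ⟨hk i hi', Nat.one_le_ceil_iff.2 (by linarith), Nat.ceil_le.2 ?_⟩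
    push_cast
    linarith
  · intro p hp q hq hpq
    have hp' : Z p < 0 := by simpa using hp
    have hq' : Z q < 0 := by simpa using hq
    obtain ⟨e₁, e₂⟩ := Prod.mk.inj hpq
    by_contra hne
    have hceil : |Z p - Z q| < 1 / 7 := by
      have a₁ := Nat.ceil_lt_add_one (a := 7 * -Z p) (by linarith)
      have a₂ := Nat.ceil_lt_add_one (a := 7 * -Z q) (by linarith)
      have a₃ := Nat.le_ceil (7 * -Z p)
      have a₄ := Nat.le_ceil (7 * -Z q)
      rw [e₂] at a₁ a₃
      rw [abs_lt]
      constructor <;> linarith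
    have hratio : ∀ r s, Z r < 0 → Z s < 0 → k r = k s → X r * Y s < 4 / 3 * (Y r * X s) := by
      intro r s hr hs e
      have b₁ := hk₂ r hr
      have b₂ := hk₁ s hs
      rw [e, pow_succ] at b₁
      have hY : ∀ r, Z r < 0 → 0 < Y r := fun r hr => by
        linarith [h.sum_eq r, h.x_le_three_mul_y hr]
      have b₃ := mul_lt_mul_of_pos_right b₁ (hY s hs)
      have b₄ := mul_le_mul_of_nonneg_right b₂ (hY r hr).le
      linarith
    have hXq : 0 < X q := by linarith [h.sum_eq q, h.swap.x_le_three_mul_y hq']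
    have hpc : p ≠ c := by rintro rfl; linarith [h.coord_c.2.2]
    have hqc : q ≠ c := by rintro rfl; linarith [h.coord_c.2.2]
    rcases (h.det_ne_zero hne hpc hqc hXq.ne').lt_or_gt with hD | hD
    · exact h.cap_pair (Ne.symm hne) hq' hp' (by rwa [abs_sub_comm])
        (hratio q p hq' hp' e₁.symm) (by linarith)
    · exact h.cap_pair hne hp' hq' hceil (hratio p q hp' hq' e₁) hD

/-! ### Points inside the triangle `abc` -/

/-- By `hD` and `hE`, passing from `p` to `q` scales `X` least and `Z` most, so `pc` crosses `qa`.
Closeness of the points puts the crossing in the stub at `p`, hence it must lie in the middle half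
of `qa`. Its two ends give the lower and upper bounds on the growth of `Y / X`; the lower bound
passes on to `Z / X`. -/
theorem precedes_aux (h : StubFrame a b c X Y Z) {p q : ι} (hpq : p ≠ q) (hXp : 0 < X p)
    (hYp : 0 < Y p) (hZp : 0 < Z p) (hXq : 0 < X q) (hYq : 0 < Y q) (hZq : 0 < Z q)
    (hZd : 3 * (Z q / X q - Z p / X p) < 1)
    (hD : 0 < X p * Y q - Y p * X q) (hE : 0 < Y p * Z q - Z p * Y q) :
    Precedes (fun i => Y i / X i) (fun i => Z i / X i) p q := by
  have hsp := h.sum_eq p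
  have hsq := h.sum_eq q
  have hpc : p ≠ c := by rintro rfl; linarith [h.coord_c.2.1]
  have hpa : p ≠ a := by rintro rfl; linarith [h.coord_a.2.1]
  have hqa : q ≠ a := by rintro rfl; linarith [h.coord_a.2.1]
  have hXp₁ : X p < 1 := by linarith
  have e₁ : 1 + Y q / X q + Z q / X q = 1 / X q := by field_simp; linarith
  have hd : Z q * X p - Z p * X q < X p * X q / 3 := by
    have := mul_lt_mul_of_pos_right hZd (mul_pos hXp hXq)
    have e : 3 * (Z q / X q - Z p / X p) * (X p * X q) = 3 * (Z q * X p - Z p * X q) := by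
      field_simp
    linarith
  have hE' : 3 * (Y p * Z q - Z p * Y q) < Y q := by
    have : X q * (Y p * Z q - Z p * Y q) ≤ Y q * (Z q * X p - Z p * X q) := by nlinarith
    have : Y q * (Z q * X p - Z p * X q) < Y q * (X p * X q / 3) := mul_lt_mul_of_pos_left hd hYq
    have : X q * (3 * (Y p * Z q - Z p * Y q)) < X q * Y q := by nlinarith [mul_pos hXq hYq]
    exact lt_of_mul_lt_mul_left this hXq.le
  have h₁ : Y p ≤ 3 * (X p * Y q - Y p * X q) := by
    by_contra! hD'
    exact h.not_cross_near hpq hpc hqa hE hD hE' hD'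
  have h₂ : X p * Y q - Y p * X q ≤ 3 * Y p := by
    by_contra! hD'
    exact h.not_cross_far hpc hpa hqa hYp hE hE' hD'
  unfold Precedes
  dsimp only
  rw [e₁]
  refine ⟨?_, ?_, Or.inl ?_⟩
  · rw [div_sub_div _ _ hXq.ne' hXp.ne', div_mul_div_comm, ← mul_div_assoc,
      div_le_div_iff₀ (by positivity) (by positivity)]
    nlinarith [mul_pos hXp hXq]
  · have : Z p ≤ 3 * (X p * Z q - Z p * X q) := by
      have : Y p * Z p ≤ Y p * (3 * (X p * Z q - Z p * X q)) := by nlinarith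
      exact le_of_mul_le_mul_left this hYp
    rw [div_sub_div _ _ hXq.ne' hXp.ne', div_mul_div_comm, ← mul_div_assoc,
      div_le_div_iff₀ (by positivity) (by positivity)]
    nlinarith [mul_pos hXp hXq]
  · rw [div_sub_div _ _ hXq.ne' hXp.ne', mul_assoc, div_mul_div_comm, ← mul_div_assoc,
      div_le_div_iff₀ (by positivity) (by positivity)]
    nlinarith [mul_pos hXp hXq]

/-- The stubs at two points inside the triangle towards `b` and `c` meet if `X` is the coordinate
with the middle ratio. -/
theorem not_middle (h : StubFrame a b c X Y Z) {p q : ι} (hpq : p ≠ q) (hXp : 0 < X p)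
    (hYp : 0 < Y p) (hZp : 0 < Z p) (hXq : 0 < X q) (hYq : 0 < Y q) (hZq : 0 < Z q)
    (hYd : 3 * (Y p / X p - Y q / X q) < 1) (hZd : 3 * (Z q / X q - Z p / X p) < 1)
    (hD : 0 < Y p * X q - X p * Y q) (hE : 0 < X p * Z q - Z p * X q) : False := by
  have hsp := h.sum_eq p
  have hsq := h.sum_eq q
  have hpc : p ≠ c := by rintro rfl; linarith [h.coord_c.2.1]
  have hqb : q ≠ b := by rintro rfl; linarith [h.coord_b.1]
  have e₁ : 3 * (Y p / X p - Y q / X q) * (X p * X q) = 3 * (Y p * X q - X p * Y q) := by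
    field_simp
  have e₂ : 3 * (Z q / X q - Z p / X p) * (X p * X q) = 3 * (X p * Z q - Z p * X q) := by
    field_simp
  have h₁ := mul_lt_mul_of_pos_right hYd (mul_pos hXp hXq)
  have h₂ := mul_lt_mul_of_pos_right hZd (mul_pos hXp hXq)
  refine h.swap.not_cross_near hpq hpc hqb hE hD ?_ ?_
  · nlinarith
  · nlinarith

theorem precedes_or (h : StubFrame a b c X Y Z) {p q : ι} (hpq : p ≠ q) (hXp : 0 < X p)
    (hYp : 0 < Y p) (hZp : 0 < Z p) (hXq : 0 < X q) (hYq : 0 < Y q) (hZq : 0 < Z q)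
    (hYd : 3 * |Y p / X p - Y q / X q| < 1) (hZd : 3 * |Z p / X p - Z q / X q| < 1) :
    Precedes (fun i => Y i / X i) (fun i => Z i / X i) p q ∨
      Precedes (fun i => Y i / X i) (fun i => Z i / X i) q p := by
  have hYd₁ := le_abs_self (Y p / X p - Y q / X q)
  have hYd₂ := neg_abs_le (Y p / X p - Y q / X q)
  have hZd₁ := le_abs_self (Z p / X p - Z q / X q)
  have hZd₂ := neg_abs_le (Z p / X p - Z q / X q)
  have nc (r) (hr : 0 < Y r) : r ≠ c := by rintro rfl; linarith [h.coord_c.2.1]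
  have nb (r) (hr : 0 < X r) : r ≠ b := by rintro rfl; linarith [h.coord_b.1]
  have na (r) (hr : 0 < Y r) : r ≠ a := by rintro rfl; linarith [h.coord_a.2.1]
  have hf := h.rotate.rotate.swap
  -- The signs order the ratios of the coordinates of `q` to those of `p`. `X` cannot be the middle
  -- one; if it is extreme, the order of the other two decides whether the frame is reflected.
  rcases (h.det_ne_zero hpq (nc p hYp) (nc q hYq) hXq.ne').lt_or_gt with hD | hD <;>
  rcases (h.rotate.rotate.det_ne_zero hpq (nb p hXp) (nb q hXq) hZq.ne').lt_or_gt with hF | hF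
  · exact (h.not_middle hpq hXp hYp hZp hXq hYq hZq (by linarith) (by linarith) (by linarith)
      (by linarith)).elim
  · right
    rcases (h.rotate.det_ne_zero hpq (na p hYp) (na q hYq) hYq.ne').lt_or_gt with hE | hE
    · exact h.precedes_aux hpq.symm hXq hYq hZq hXp hYp hZp (by linarith) (by linarith)
        (by linarith)
    · exact (hf.precedes_aux hpq.symm hXq hZq hYq hXp hZp hYp (by linarith) (by linarith)
        (by linarith)).swap
  · left
    rcases (h.rotate.det_ne_zero hpq (na p hYp) (na q hYq) hYq.ne').lt_or_gt with hE | hE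
    · exact (hf.precedes_aux hpq hXp hZp hYp hXq hZq hYq (by linarith) (by linarith)
        (by linarith)).swap
    · exact h.precedes_aux hpq hXp hYp hZp hXq hYq hZq (by linarith) (by linarith)
        (by linarith)
  · exact (h.not_middle hpq.symm hXq hYq hZq hXp hYp hZp (by linarith) (by linarith) (by linarith)
      (by linarith)).elim

theorem three_mul_abs_sub_lt_of_ceil_eq {x y : ℝ} (hx : 0 < x) (hy : 0 < y)
    (h : ⌈3 * x⌉₊ = ⌈3 * y⌉₊) : 3 * |x - y| < 1 := by
  have a₁ := Nat.ceil_lt_add_one (a := 3 * x) (by linarith)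
  have a₂ := Nat.ceil_lt_add_one (a := 3 * y) (by linarith)
  have a₃ := Nat.le_ceil (3 * x)
  have a₄ := Nat.le_ceil (3 * y)
  rw [h] at a₁ a₃
  rcases abs_cases (x - y) with ⟨e, -⟩ | ⟨e, -⟩ <;> rw [e] <;> linarith

theorem card_kite_le [Fintype ι] (h : StubFrame a b c X Y Z) :
    (Finset.univ.filter fun i => 0 < Y i ∧ 0 < Z i ∧ Y i ≤ X i ∧ Z i ≤ X i).card ≤ 21 := by
  set S := Finset.univ.filter fun i => 0 < Y i ∧ 0 < Z i ∧ Y i ≤ X i ∧ Z i ≤ X i with hS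
  have hpos : ∀ i ∈ S, 0 < X i ∧ 0 < Y i ∧ 0 < Z i := by
    intro i hi
    obtain ⟨h₁, h₂, h₃, -⟩ := (Finset.mem_filter.1 hi).2
    exact ⟨h₁.trans_le h₃, h₁, h₂⟩
  have hle : ∀ i ∈ S, Y i / X i ≤ 1 ∧ Z i / X i ≤ 1 := by
    intro i hi
    obtain ⟨-, -, h₃, h₄⟩ := (Finset.mem_filter.1 hi).2
    exact ⟨div_le_one_of_le₀ h₃ (hpos i hi).1.le, div_le_one_of_le₀ h₄ (hpos i hi).1.le⟩
  have hpos' : ∀ i ∈ S, 0 < Y i / X i ∧ 0 < Z i / X i := fun i hi =>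
    ⟨div_pos (hpos i hi).2.1 (hpos i hi).1, div_pos (hpos i hi).2.2 (hpos i hi).1⟩
  have hmaps : ∀ i ∈ S, (⌈3 * (Y i / X i)⌉₊, ⌈3 * (Z i / X i)⌉₊) ∈
      Finset.Icc 1 3 ×ˢ Finset.Icc 1 3 := by
    intro i hi
    have h₁ := hpos' i hi
    have h₂ := hle i hi
    simp only [Finset.mem_product, Finset.mem_Icc]
    refine ⟨⟨Nat.one_le_ceil_iff.2 (by linarith), Nat.ceil_le.2 ?_⟩,
      Nat.one_le_ceil_iff.2 (by linarith), Nat.ceil_le.2 ?_⟩ <;> push_cast <;> linarith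
  rw [Finset.card_eq_sum_card_fiberwise hmaps]
  -- Five cells touch the top range of a coordinate, three more the middle range, and one is left at
  -- the corner `a`.
  have hsum : ∑ k ∈ Finset.Icc 1 3 ×ˢ Finset.Icc 1 3,
      (if k.1 = 3 ∨ k.2 = 3 then 1 else if k.1 = 2 ∨ k.2 = 2 then 3 else 7) = 21 := rfl
  rw [← hsum]
  refine Finset.sum_le_sum fun k hk => ?_
  have hchain : IsPrecedesChain (fun i => Y i / X i) (fun i => Z i / X i)
      (S.filter fun i => (⌈3 * (Y i / X i)⌉₊, ⌈3 * (Z i / X i)⌉₊) = k) := by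
    refine ⟨fun i hi => hpos' i (Finset.mem_filter.1 hi).1, fun i hi j hj hij => ?_⟩
    obtain ⟨hiS, hik⟩ := Finset.mem_filter.1 hi
    obtain ⟨hjS, hjk⟩ := Finset.mem_filter.1 hj
    obtain ⟨e₁, e₂⟩ := Prod.mk.inj (hik.trans hjk.symm)
    obtain ⟨p₁, p₂, p₃⟩ := hpos i hiS
    obtain ⟨q₁, q₂, q₃⟩ := hpos j hjS
    exact h.precedes_or hij p₁ p₂ p₃ q₁ q₂ q₃
      (three_mul_abs_sub_lt_of_ceil_eq (hpos' i hiS).1 (hpos' j hjS).1 e₁)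
      (three_mul_abs_sub_lt_of_ceil_eq (hpos' i hiS).2 (hpos' j hjS).2 e₂)
  have hcell : ∀ x : ℝ, 0 < x → ((⌈3 * x⌉₊ : ℕ) : ℝ) - 1 < 3 * x ∧ 3 * x ≤ (⌈3 * x⌉₊ : ℕ) :=
    fun x hx => ⟨by linarith [Nat.ceil_lt_add_one (a := 3 * x) (by linarith)], Nat.le_ceil _⟩
  have hbd : ∀ i ∈ S.filter fun i => (⌈3 * (Y i / X i)⌉₊, ⌈3 * (Z i / X i)⌉₊) = k,
      ((k.1 : ℝ) - 1 < 3 * (Y i / X i) ∧ 3 * (Y i / X i) ≤ k.1) ∧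
      ((k.2 : ℝ) - 1 < 3 * (Z i / X i) ∧ 3 * (Z i / X i) ≤ k.2) := by
    intro i hi
    obtain ⟨hiS, rfl⟩ := Finset.mem_filter.1 hi
    exact ⟨hcell _ (hpos' i hiS).1, hcell _ (hpos' i hiS).2⟩
  obtain ⟨k₁, k₂⟩ := k
  simp only [Finset.mem_product, Finset.mem_Icc] at hk
  dsimp only at hbd ⊢
  split_ifs with h₁ h₂
  · rcases h₁ with rfl | rfl
    · refine hchain.card_le_one fun i hi => ?_
      have := hbd i hi
      norm_num at this
      constructor <;> linarith
    · refine hchain.swap.card_le_one fun i hi => ?_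
      have := hbd i hi
      norm_num at this
      constructor <;> linarith
  · rcases h₂ with rfl | rfl
    · refine hchain.card_le_three fun i hi => ?_
      have := hbd i hi
      norm_num at this
      constructor <;> linarith
    · refine hchain.swap.card_le_three fun i hi => ?_
      have := hbd i hi
      norm_num at this
      constructor <;> linarith
  · obtain rfl : k₁ = 1 := by omega
    obtain rfl : k₂ = 1 := by omega
    refine hchain.card_le_seven fun i hi => ?_
    have := hbd i hi
    norm_num at this
    constructor <;> linarith

/-! ### Adding up corners, kites and caps. -/

theorem card_le [Fintype ι] (h : StubFrame a b c X Y Z) : Fintype.card ι ≤ 234 := by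
  classical
  have hcover : (Finset.univ : Finset ι) ⊆ ({a, b, c} ∪
      ((Finset.univ.filter fun i => 0 < Y i ∧ 0 < Z i ∧ Y i ≤ X i ∧ Z i ≤ X i) ∪
      (Finset.univ.filter fun i => 0 < Z i ∧ 0 < X i ∧ Z i ≤ Y i ∧ X i ≤ Y i) ∪
      (Finset.univ.filter fun i => 0 < X i ∧ 0 < Y i ∧ X i ≤ Z i ∧ Y i ≤ Z i))) ∪
      ((Finset.univ.filter fun i => Z i < 0) ∪ (Finset.univ.filter fun i => X i < 0) ∪
      (Finset.univ.filter fun i => Y i < 0)) := by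
    intro i _
    simp only [Finset.mem_union, Finset.mem_insert, Finset.mem_singleton, Finset.mem_filter,
      Finset.mem_univ, true_and]
    by_cases ha : i = a
    · simp [ha]
    by_cases hb : i = b
    · simp [hb]
    by_cases hc : i = c
    · simp [hc]
    rcases (h.z_ne_zero ha hb).lt_or_gt with hz | hz
    · simp [hz]
    rcases (h.rotate.z_ne_zero hb hc).lt_or_gt with hx | hx
    · simp [hx]
    rcases (h.rotate.rotate.z_ne_zero hc ha).lt_or_gt with hy | hy
    · simp [hy]
    left
    right
    rcases le_total (X i) (Y i) with h₁ | h₁ <;> rcases le_total (Y i) (Z i) with h₂ | h₂ <;>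
      rcases le_total (X i) (Z i) with h₃ | h₃ <;> simp [hx, hy, hz, h₁, h₂, h₃] <;>
      exact Or.inl (Or.inl (by linarith))
  have k₁ := h.card_kite_le
  have k₂ := h.rotate.card_kite_le
  have k₃ := h.rotate.rotate.card_kite_le
  have c₁ := h.card_cap_le
  have c₂ := h.rotate.card_cap_le
  have c₃ := h.rotate.rotate.card_cap_le
  have h₀ : ({a, b, c} : Finset ι).card ≤ 3 := Finset.card_le_three
  refine (Finset.card_le_card hcover).trans ?_
  refine (Finset.card_union_le _ _).trans ?_
  have u₁ := Finset.card_union_le ({a, b, c} : Finset ι)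
    ((Finset.univ.filter fun i => 0 < Y i ∧ 0 < Z i ∧ Y i ≤ X i ∧ Z i ≤ X i) ∪
      (Finset.univ.filter fun i => 0 < Z i ∧ 0 < X i ∧ Z i ≤ Y i ∧ X i ≤ Y i) ∪
      (Finset.univ.filter fun i => 0 < X i ∧ 0 < Y i ∧ X i ≤ Z i ∧ Y i ≤ Z i))
  have u₂ := Finset.card_union_le
    ((Finset.univ.filter fun i => 0 < Y i ∧ 0 < Z i ∧ Y i ≤ X i ∧ Z i ≤ X i) ∪
      (Finset.univ.filter fun i => 0 < Z i ∧ 0 < X i ∧ Z i ≤ Y i ∧ X i ≤ Y i))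
    (Finset.univ.filter fun i => 0 < X i ∧ 0 < Y i ∧ X i ≤ Z i ∧ Y i ≤ Z i)
  have u₃ := Finset.card_union_le
    (Finset.univ.filter fun i => 0 < Y i ∧ 0 < Z i ∧ Y i ≤ X i ∧ Z i ≤ X i)
    (Finset.univ.filter fun i => 0 < Z i ∧ 0 < X i ∧ Z i ≤ Y i ∧ X i ≤ Y i)
  have u₄ := Finset.card_union_le
    ((Finset.univ.filter fun i => Z i < 0) ∪ (Finset.univ.filter fun i => X i < 0))
    (Finset.univ.filter fun i => Y i < 0)
  have u₅ := Finset.card_union_le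
    (Finset.univ.filter fun i => Z i < 0) (Finset.univ.filter fun i => X i < 0)
  omega

end StubFrame

/-! ### The frame of a triangle of maximal area. -/

/-- Twice the signed area of a triangle in the plane. -/
def signedArea (x y z : EuclideanSpace ℝ (Fin 2)) : ℝ :=
  (y 0 - x 0) * (z 1 - x 1) - (y 1 - x 1) * (z 0 - x 0)

namespace IsSHPED

variable {ι : Type*} {p : ι → EuclideanSpace ℝ (Fin 2)}

theorem stubSep (h : IsSHPED (SimpleGraph.completeGraph ι) (1 / 4) p) :
    StubSep (fun i => p i 0) (fun i => p i 1) := by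
  intro i j k l hij hkl hne s t hs hs' ht ht' e₀ e₁
  have hd := h.disjoint ⟨(i, j), hij⟩ ⟨(k, l), hkl⟩ (by
    intro e
    have := congrArg SimpleGraph.Dart.toProd e
    obtain ⟨h₁, h₂⟩ := Prod.mk.inj this
    exact hne.elim (· h₁) (· h₂))
  refine Set.disjoint_left.1 hd ⟨s, ⟨hs, hs'⟩, rfl⟩ ⟨t, ⟨ht, ht'⟩, ?_⟩
  ext r
  fin_cases r
  · simp [AffineMap.lineMap_apply]
    linarith
  · simp [AffineMap.lineMap_apply]
    linarith

theorem signedArea_ne_zero (h : IsSHPED (SimpleGraph.completeGraph ι) (1 / 4) p)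
    {i j k : ι} (hij : i ≠ j) (hik : i ≠ k) (hjk : j ≠ k) : signedArea (p i) (p j) (p k) ≠ 0 := by
  intro h₀
  unfold signedArea at h₀
  by_cases hx : p j 0 - p i 0 = 0
  · by_cases hy : p j 1 - p i 1 = 0
    · apply hij
      apply h.injective
      ext r
      fin_cases r
      · exact (sub_eq_zero.1 hx).symm
      · exact (sub_eq_zero.1 hy).symm
    · refine h.stubSep.not_collinear hij hik hjk (t := (p k 1 - p i 1) / (p j 1 - p i 1)) ?_ ?_ <;>
        field_simp <;> linarith
  · refine h.stubSep.not_collinear hij hik hjk (t := (p k 0 - p i 0) / (p j 0 - p i 0)) ?_ ?_ <;>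
      field_simp <;> linarith

theorem exists_stubFrame [Fintype ι] (h : IsSHPED (SimpleGraph.completeGraph ι) (1 / 4) p)
    {i j k : ι} (hij : i ≠ j) (hik : i ≠ k) (hjk : j ≠ k) :
    ∃ (a b c : ι) (X Y Z : ι → ℝ), StubFrame a b c X Y Z := by
  obtain ⟨⟨a, b, c⟩, -, hmax⟩ := (Finset.univ : Finset (ι × ι × ι)).exists_max_image
    (fun t => |signedArea (p t.1) (p t.2.1) (p t.2.2)|) ⟨(i, j, k), Finset.mem_univ _⟩
  have hpos : 0 < |signedArea (p a) (p b) (p c)| :=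
    (abs_pos.2 (h.signedArea_ne_zero hij hik hjk)).trans_le (hmax (i, j, k) (Finset.mem_univ _))
  have hne : signedArea (p a) (p b) (p c) ≠ 0 := abs_pos.1 hpos
  have bound : ∀ x y z, -1 ≤ signedArea (p x) (p y) (p z) / signedArea (p a) (p b) (p c) ∧
      signedArea (p x) (p y) (p z) / signedArea (p a) (p b) (p c) ≤ 1 := by
    intro x y z
    rw [← abs_le, abs_div]
    exact div_le_one_of_le₀ (hmax (x, y, z) (Finset.mem_univ _)) hpos.le
  refine ⟨a, b, c, fun i => signedArea (p i) (p b) (p c) / signedArea (p a) (p b) (p c),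
    fun i => signedArea (p a) (p i) (p c) / signedArea (p a) (p b) (p c),
    fun i => signedArea (p a) (p b) (p i) / signedArea (p a) (p b) (p c), ?_⟩
  have coord : ∀ i r, p i r * signedArea (p a) (p b) (p c) =
      signedArea (p i) (p b) (p c) * p a r + signedArea (p a) (p i) (p c) * p b r +
      signedArea (p a) (p b) (p i) * p c r := by
    intro i r
    fin_cases r <;> simp [signedArea] <;> ring
  have sum : ∀ i, signedArea (p i) (p b) (p c) + signedArea (p a) (p i) (p c) +
      signedArea (p a) (p b) (p i) = signedArea (p a) (p b) (p c) := by
    intro i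
    simp only [signedArea]
    ring
  refine ⟨fun i => ?_, ⟨div_self hne, ?_, ?_⟩, ⟨?_, div_self hne, ?_⟩, ⟨?_, ?_, div_self hne⟩,
    fun i => bound _ _ _, fun i => bound _ _ _, fun i => bound _ _ _, ?_⟩
  · rw [← add_div, ← add_div, sum, div_self hne]
  any_goals exact div_eq_zero_iff.2 (Or.inl (by simp only [signedArea]; ring))
  intro i j k l hij hkl hne' s t hs hs' ht ht' e₁ e₂
  field_simp at e₁ e₂
  refine h.stubSep i j k l hij hkl hne' s t hs hs' ht ht' (mul_right_cancel₀ hne ?_)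
    (mul_right_cancel₀ hne ?_)
  · linear_combination (1 - s) * coord i 0 + s * coord j 0 - (1 - t) * coord k 0 - t * coord l 0 +
      (p a 0 - p c 0) * e₁ + (p b 0 - p c 0) * e₂ + p c 0 * ((1 - s) * sum i + s * sum j -
      (1 - t) * sum k - t * sum l)
  · linear_combination (1 - s) * coord i 1 + s * coord j 1 - (1 - t) * coord k 1 - t * coord l 1 +
      (p a 1 - p c 1) * e₁ + (p b 1 - p c 1) * e₂ + p c 1 * ((1 - s) * sum i + s * sum j -
      (1 - t) * sum k - t * sum l)

end IsSHPED

theorem mainTheorem1 (n : ℕ) (hn : 240 < n) :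
    ¬ HasSHPED (SimpleGraph.completeGraph (Fin n)) (1 / 4 : ℝ) := by
  rintro ⟨p, hp⟩
  obtain ⟨a, b, c, X, Y, Z, h⟩ := hp.exists_stubFrame (i := ⟨0, by omega⟩) (j := ⟨1, by omega⟩)
    (k := ⟨2, by omega⟩) (by simp) (by simp) (by simp)
  have := h.card_le
  rw [Fintype.card_fin] at this
  omega
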